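/- A quantum graph $G$ consists of a finite-dimensional complex inner product space $V(G)$ and a real vector space $E(G)$ of self-adjoint operators on $V(G)$ that contains the identity. Its order is $\dim_{\mathbb C} V(G)$ and its valence is $\dim_{\mathbb R} E(G)-1$. A code of $G$ is a subspace $C\subseteq V(G)$ such that, for some function $\epsilon_C:E(G)\to\mathbb R$, $P_CAP_C=\epsilon_C(A)P_C$ for all $A\in E(G)$, where $P_C$ is the orthogonal projection onto $C$. Let $\alpha(G)$ be the largest dimension of a code of $G$, and let $\alpha(n,m)$ be the minimum of $\alpha(G)$ over all quantum graphs $G$ of order $n$ and valence $m$. Then for all integers $n\ge 1$ and $m\ge 0$ with $m+1\le n^2$ (that is, for all $n,m$ for which a quantum graph of order $n$ and valence $m$ exists), $$\left\lceil\frac{n}{m+1}\right\rceil\ \ge\ \alpha(n,m)\ \ge\ \left\lceil\frac{n}{(m+1)^2}\right\rceil .$$ -/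

import Mathlib

universe u

/-- A quantum graph with vertex space `V`, a finite-dimensional complex inner product space: a real
vector space of self-adjoint operators on `V` (the edge space) that contains the identity. -/
structure QuantumGraph (V : Type u) [NormedAddCommGroup V] [InnerProductSpace ℂ V]
    [FiniteDimensional ℂ V] where
  /-- The edge space. -/
  edges : Submodule ℝ (V →ₗ[ℂ] V)
  isSymmetric_of_mem : ∀ A ∈ edges, A.IsSymmetric
  id_mem : LinearMap.id ∈ edges

namespace QuantumGraph

variable {V : Type u} [NormedAddCommGroup V] [InnerProductSpace ℂ V] [FiniteDimensional ℂ V]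

/-- The order: the complex dimension of the vertex space. -/
noncomputable def order (_G : QuantumGraph V) : ℕ := Module.finrank ℂ V

/-- The valence: one less than the real dimension of the edge space (an integer, so that the
subtraction is not truncated). -/
noncomputable def valence (G : QuantumGraph V) : ℤ := (Module.finrank ℝ G.edges : ℤ) - 1

/-- A subspace `C` is a code if there is a function `ε` (its slope) with `P A P = ε(A) P` for every
edge operator `A`, where `P` is the orthogonal projection onto `C`. -/
def IsCode (G : QuantumGraph V) (C : Submodule ℂ V) : Prop :=
  ∃ ε : G.edges → ℝ, ∀ A : G.edges,
    (C.starProjection : V →ₗ[ℂ] V) ∘ₗ (A : V →ₗ[ℂ] V) ∘ₗ (C.starProjection : V →ₗ[ℂ] V) =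
      ε A • (C.starProjection : V →ₗ[ℂ] V)

/-- The independence number: the largest dimension of a code. The zero subspace is always a code,
and dimensions are at most that of `V`, so this is a maximum. -/
noncomputable def independenceNumber (G : QuantumGraph V) : ℕ :=
  sSup {d : ℕ | ∃ C : Submodule ℂ V, G.IsCode C ∧ Module.finrank ℂ C = d}

end QuantumGraph

/-- The least independence number among all quantum graphs of order `n` and valence `m`. -/
noncomputable def minIndependenceNumber (n m : ℕ) : ℕ :=
  sInf {a : ℕ | ∃ (V : Type u) (_ : NormedAddCommGroup V) (_ : InnerProductSpace ℂ V)
    (_ : FiniteDimensional ℂ V) (G : QuantumGraph V),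
    G.order = n ∧ G.valence = m ∧ G.independenceNumber = a}

/-! Put D = m + 1. For the lower bound, let q = ⌈n / D²⌉ - 1. A greedy choice gives qD + 1
orthonormal vectors between which no edge operator has off-diagonal entries. Their expectation
values are points of ℝ^D, and a Tverberg argument (Bárány's colorful Carathéodory theorem with
Sarkaria's tensor trick) splits them into q + 1 classes with equal weighted sums. Superposing each
class with square-root weights gives q + 1 vectors spanning a code. The identity has expectation 1
at every vector, so the classes also have equal, hence positive, total weight.

For the upper bound, cut an orthonormal basis into D classes of size at most ⌈n / D⌉ and let the
coordinate projections be edges. They sum to the identity, so on a nonzero code one of them has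
nonzero slope, and its rank bounds the dimension of the code. -/

open scoped InnerProductSpace

/-! ### Convex geometry: colorful Carathéodory and Tverberg -/

/-- If `x` is nearest to the origin on the segment from `x` to `y`, then `y` lies beyond the
hyperplane through `x` orthogonal to `x`. -/
theorem real_inner_self_le_inner_of_forall_norm_le {H : Type*} [NormedAddCommGroup H]
    [InnerProductSpace ℝ H] {x y : H}
    (h : ∀ t : ℝ, 0 ≤ t → t ≤ 1 → ‖x‖ ≤ ‖x + t • (y - x)‖) : ⟪x, x⟫_ℝ ≤ ⟪x, y⟫_ℝ := by
  by_contra! hlt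
  set d := y - x with hd
  have hxd : ⟪x, d⟫_ℝ < 0 := by rw [hd, inner_sub_right]; linarith
  have hd0 : 0 < ‖d‖ ^ 2 := by
    have : d ≠ 0 := by rintro h0; simp [h0] at hxd
    positivity
  -- For such t the quadratic term t²‖d‖² absorbs at most half of the first-order decrease 2t⟪x, d⟫.
  obtain ⟨t, ht0, ht1, htd⟩ : ∃ t : ℝ, 0 < t ∧ t ≤ 1 ∧ t * ‖d‖ ^ 2 ≤ -⟪x, d⟫_ℝ := by
    refine ⟨min 1 (-⟪x, d⟫_ℝ / ‖d‖ ^ 2), lt_min one_pos (by apply div_pos <;> linarith),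
      min_le_left _ _, ?_⟩
    rw [← le_div_iff₀ hd0]
    exact min_le_right _ _
  have h1 : ‖x‖ ^ 2 ≤ ‖x + t • d‖ ^ 2 := pow_le_pow_left₀ (norm_nonneg _) (h t ht0.le ht1) 2
  rw [norm_add_sq_real, norm_smul, inner_smul_right, mul_pow, Real.norm_eq_abs, sq_abs] at h1
  nlinarith

/-- Moving a positive weight vector along a direction with a negative coordinate, one reaches a
nonnegative weight vector with a vanishing coordinate. -/
theorem exists_nonneg_add_mul_eq_zero {ι : Type*} [Fintype ι] {l c : ι → ℝ} (hl : ∀ i, 0 < l i)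
    (hc : ∃ i, c i < 0) : ∃ t : ℝ, (∀ i, 0 ≤ l i + t * c i) ∧ ∃ i, l i + t * c i = 0 := by
  classical
  obtain ⟨i, hi, hmin⟩ := Finset.exists_min_image (Finset.univ.filter fun i => c i < 0)
    (fun i => l i / -c i) (by obtain ⟨i, hi⟩ := hc; exact ⟨i, by simpa using hi⟩)
  simp only [Finset.mem_filter, Finset.mem_univ, true_and] at hi hmin
  refine ⟨l i / -c i, fun j => ?_, i, by have := hi.ne; field_simp; ring⟩
  rcases lt_or_ge (c j) 0 with hj | hj
  · have := hmin j hj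
    rw [le_div_iff₀ (by linarith)] at this
    linarith
  · have : 0 < l i / -c i := div_pos (hl i) (by linarith)
    have := hl j
    positivity

/-- The colorful Carathéodory theorem: if the origin is in the convex hull of each of more than
`dim H` finite families, then one can choose a member of each so that the origin is a convex
combination of the chosen points. -/
theorem exists_colorful_convex_combination {H ι κ : Type*} [NormedAddCommGroup H]
    [InnerProductSpace ℝ H] [FiniteDimensional ℝ H] [Fintype ι] [Finite κ]
    (hcard : Module.finrank ℝ H < Fintype.card ι) (p : ι → κ → H)
    (hp : ∀ i, 0 ∈ convexHull ℝ (Set.range (p i))) :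
    ∃ s : ι → κ, ∃ l ∈ stdSimplex ℝ ι, ∑ i, l i • p i (s i) = 0 := by
  classical
  have : Nonempty ι := Fintype.card_pos_iff.mp (by omega)
  have hκ : Nonempty κ := by
    by_contra h
    rw [not_nonempty_iff] at h
    simpa [Set.range_eq_empty] using hp (Classical.arbitrary ι)
  let F : (ι → κ) → (ι → ℝ) → H := fun s l => ∑ i, l i • p i (s i)
  have hmin (s : ι → κ) : ∃ l ∈ stdSimplex ℝ ι, ∀ l' ∈ stdSimplex ℝ ι, ‖F s l‖ ≤ ‖F s l'‖ := by
    obtain ⟨l, hl, h⟩ := (isCompact_stdSimplex ℝ ι).exists_isMinOn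
      ⟨_, single_mem_stdSimplex ℝ (Classical.arbitrary ι)⟩
      (f := fun l => ‖F s l‖) (by fun_prop)
    exact ⟨l, hl, fun l' hl' => h hl'⟩
  choose L hL hLmin using hmin
  -- Bárány's argument: minimize the distance to the origin over choices and weights together.
  obtain ⟨s, hs⟩ := Finite.exists_min fun s => ‖F s (L s)‖
  have hmin (s' : ι → κ) (l' : ι → ℝ) (h : l' ∈ stdSimplex ℝ ι) : ‖F s (L s)‖ ≤ ‖F s' l'‖ :=
    (hs s').trans (hLmin s' l' h)
  generalize L s = l, hL s = hl at hmin
  refine ⟨s, l, hl, ?_⟩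
  by_contra hx0
  set x : H := ∑ i, l i • p i (s i) with hx
  have hxx : 0 < ⟪x, x⟫_ℝ := real_inner_self_pos.mpr hx0
  -- The variational inequality at any minimizing weights.
  have hvar (s' : ι → κ) (l' : ι → ℝ) (hl' : l' ∈ stdSimplex ℝ ι) (he : F s' l' = x) (i : ι) :
      ⟪x, x⟫_ℝ ≤ ⟪x, p i (s' i)⟫_ℝ := by
    refine real_inner_self_le_inner_of_forall_norm_le fun t ht0 ht1 => ?_
    have := hmin s' (l' + t • (Pi.single i 1 - l')) (by
      have := convex_stdSimplex ℝ ι hl' (single_mem_stdSimplex ℝ i) (sub_nonneg.2 ht1) ht0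
        (by ring)
      convert this using 1
      module)
    convert this using 2
    rw [← he]
    simp only [F, Pi.add_apply, Pi.smul_apply, Pi.sub_apply, add_smul, sub_smul, smul_eq_mul,
      mul_smul, Finset.sum_add_distrib, ← Finset.smul_sum, Finset.sum_sub_distrib, mul_sub]
    simp [Pi.single_apply, ite_smul, smul_sub]
  -- Minimizing weights have no vanishing coordinate, since that color could be exchanged.
  have hpos (l' : ι → ℝ) (hl' : l' ∈ stdSimplex ℝ ι) (he : F s l' = x) (i : ι) : l' i ≠ 0 := by
    intro h0
    have hsw (k : κ) : ⟪x, x⟫_ℝ ≤ ⟪x, p i k⟫_ℝ := by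
      have := hvar (Function.update s i k) l' hl' (by
        rw [← he]
        refine Finset.sum_congr rfl fun j _ => ?_
        rcases eq_or_ne j i with rfl | hj
        · simp [h0]
        · simp [hj]) i
      simpa using this
    have hsub : convexHull ℝ (Set.range (p i)) ⊆ {y | ⟪x, x⟫_ℝ ≤ ⟪x, y⟫_ℝ} :=
      convexHull_min (by rintro _ ⟨k, rfl⟩; exact hsw k)
        (convex_halfSpace_ge (f := fun y => ⟪x, y⟫_ℝ) (innerₛₗ ℝ x).isLinear _)
    have := hsub (hp i)
    simp only [Set.mem_ofPred_eq, inner_zero_right] at this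
    linarith
  have hlpos (i : ι) : 0 < l i := (hl.1 i).lt_of_ne' (hpos l hl rfl i)
  -- Hence all chosen points lie on the supporting hyperplane.
  have hplane (i : ι) : ⟪x, p i (s i)⟫_ℝ = ⟪x, x⟫_ℝ := by
    have hxs : ⟪x, x⟫_ℝ = ∑ i, l i * ⟪x, p i (s i)⟫_ℝ := by
      change ⟪x, ∑ i, l i • p i (s i)⟫_ℝ = _
      simp [inner_sum, inner_smul_right]
    have hsum : ∑ i, l i * (⟪x, p i (s i)⟫_ℝ - ⟪x, x⟫_ℝ) = 0 := by
      simp only [mul_sub, Finset.sum_sub_distrib, ← Finset.sum_mul, hl.2, one_mul]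
      linarith
    have := (Finset.sum_eq_zero_iff_of_nonneg fun i _ =>
      mul_nonneg (hl.1 i) (sub_nonneg.2 (hvar s l hl rfl i))).1 hsum i (Finset.mem_univ i)
    rcases mul_eq_zero.1 this with h | h
    · exact absurd h (hlpos i).ne'
    · linarith
  -- A linear relation among the chosen points has coefficient sum zero, because they all have the
  -- same positive inner product with x. Moving the weights along it fixes x and makes a coordinate
  -- vanish, contradicting `hpos`.
  have hdep : ¬ LinearIndependent ℝ fun i => p i (s i) := fun h => by
    have := h.fintype_card_le_finrank
    omega
  obtain ⟨c, hc, i₀, hi₀⟩ := Fintype.not_linearIndependent_iff.1 hdep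
  have hcsum : ∑ i, c i = 0 := by
    have h := congrArg (fun y => ⟪x, y⟫_ℝ) hc
    simp only [inner_sum, inner_smul_right, hplane, ← Finset.sum_mul, inner_zero_right] at h
    exact (mul_eq_zero.1 h).resolve_right hxx.ne'
  have hneg : ∃ i, c i < 0 := by
    by_contra! h
    exact hi₀ ((Finset.sum_eq_zero_iff_of_nonneg fun i _ => h i).1 hcsum i₀ (Finset.mem_univ _))
  obtain ⟨t, ht, i, hi⟩ := exists_nonneg_add_mul_eq_zero hlpos hneg
  refine hpos (fun i => l i + t * c i) ⟨ht, ?_⟩ ?_ i hi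
  · rw [Finset.sum_add_distrib, ← Finset.mul_sum, hcsum, hl.2]; simp
  · simp only [F, add_smul, mul_smul, Finset.sum_add_distrib, ← Finset.smul_sum, hc]
    simp [hx]

/-- A linear form of Tverberg's theorem: more than `q * D` points of `ℝ ^ D` carry convex weights
and a partition into `q + 1` classes such that the weighted sums over the classes agree. -/
theorem exists_equal_weighted_sums {ι δ : Type*} [Fintype ι] [Fintype δ] (q : ℕ)
    (hcard : q * Fintype.card δ < Fintype.card ι) (x : ι → δ → ℝ) :
    ∃ s : ι → Option (Fin q), ∃ l ∈ stdSimplex ℝ ι, ∃ y : δ → ℝ,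
      ∀ a, ∑ i with s i = a, l i • x i = y := by
  classical
  -- Sarkaria's trick: tensor x i with the q + 1 vectors -(1, …, 1), e_1, …, e_q of ℝ^q. Their only
  -- linear relations have all coefficients equal, so a vanishing combination means equal class
  -- sums.
  let p : ι → Option (Fin q) → EuclideanSpace ℝ (Fin q × δ) := fun i a =>
    WithLp.toLp 2 fun bj => a.elim (-x i bj.2) fun b => if b = bj.1 then x i bj.2 else 0
  have hp (i : ι) : ∑ a, p i a = 0 := by
    ext ⟨b, j⟩
    simp [p, Fintype.sum_option]
  obtain ⟨s, l, hl, h⟩ := exists_colorful_convex_combination (by simpa using hcard) p (fun i => by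
    have := Convex.sum_mem (convex_convexHull ℝ (Set.range (p i))) (t := Finset.univ)
      (w := fun _ => (1 : ℝ) / (q + 1)) (z := p i) (fun _ _ => by positivity)
      (by simp; field_simp) (fun a _ => subset_convexHull ℝ _ ⟨a, rfl⟩)
    rwa [← Finset.smul_sum, hp, smul_zero] at this)
  refine ⟨s, l, hl, ∑ i with s i = none, l i • x i, fun a => ?_⟩
  rcases a with _ | b
  · rfl
  ext j
  have := congrArg (fun z => z (b, j)) h
  simp only [WithLp.ofLp_sum, WithLp.ofLp_smul, Finset.sum_apply, Pi.smul_apply, p] at this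
  rw [Finset.sum_filter, Finset.sum_filter, ← sub_eq_zero]
  simp only [Finset.sum_apply, ← Finset.sum_sub_distrib]
  refine Eq.trans (Finset.sum_congr rfl fun i _ => ?_) this
  rcases s i with _ | b'
  · simp
  · by_cases hb : b' = b <;> simp [hb]

theorem Module.Basis.coe_eq_sum_repr {ι R M : Type*} [Fintype ι] [Semiring R] [AddCommMonoid M]
    [Module R M] {S : Submodule R M} (b : Module.Basis ι R S) (x : S) :
    (x : M) = ∑ k, b.repr x k • (b k : M) := by
  conv_lhs => rw [← b.sum_repr x]
  simp only [Submodule.coe_sum, Submodule.coe_smul]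

/-! ### Lower bound: constructing codes -/

namespace QuantumGraph

variable {V : Type u} [NormedAddCommGroup V] [InnerProductSpace ℂ V] [FiniteDimensional ℂ V]

theorem isCode_bot (G : QuantumGraph V) : G.IsCode ⊥ :=
  ⟨fun _ => 0, fun A => by ext x; simp⟩

theorem finrank_le_independenceNumber {G : QuantumGraph V} {C : Submodule ℂ V} (h : G.IsCode C) :
    Module.finrank ℂ C ≤ G.independenceNumber :=
  le_csSup ⟨Module.finrank ℂ V, by rintro _ ⟨C, -, rfl⟩; exact C.finrank_le⟩ ⟨C, h, rfl⟩

theorem independenceNumber_le {G : QuantumGraph V} {k : ℕ}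
    (h : ∀ C, G.IsCode C → Module.finrank ℂ C ≤ k) : G.independenceNumber ≤ k :=
  csSup_le ⟨_, ⊥, G.isCode_bot, rfl⟩ (by rintro _ ⟨C, hC, rfl⟩; exact h C hC)

/-- The form of the code condition that refers to inner products only. -/
theorem isCode_of_inner {G : QuantumGraph V} {C : Submodule ℂ V} (ε : G.edges → ℝ)
    (h : ∀ A : G.edges, ∀ x ∈ C, ∀ y ∈ C, ⟪x, (A : V →ₗ[ℂ] V) y⟫_ℂ = (ε A : ℂ) * ⟪x, y⟫_ℂ) :
    G.IsCode C := by
  refine ⟨ε, fun A => LinearMap.ext fun z => ext_inner_left ℂ fun w => ?_⟩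
  have := h A _ (C.starProjection_apply_mem w) _ (C.starProjection_apply_mem z)
  simp only [LinearMap.comp_apply, LinearMap.smul_apply, ContinuousLinearMap.coe_coe]
  rw [← Submodule.inner_starProjection_left_eq_right, this,
    Submodule.inner_starProjection_left_eq_right,
    Submodule.starProjection_eq_self_iff.2 (C.starProjection_apply_mem z),
    RCLike.real_smul_eq_coe_smul (K := ℂ), inner_smul_right]
  rfl

/-- Orthonormal vectors without transitions between them, chosen greedily. -/
theorem exists_orthonormal_inner_eq_zero (G : QuantumGraph V) (N : ℕ)
    (hN : ∀ k < N, k * Module.finrank ℝ G.edges < Module.finrank ℂ V) :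
    ∃ v : Fin N → V, Orthonormal ℂ v ∧
      ∀ A ∈ G.edges, ∀ i j, i ≠ j → ⟪v i, A (v j)⟫_ℂ = 0 := by
  induction N with
  | zero => exact ⟨fun i => i.elim0, ⟨fun i => i.elim0, fun i => i.elim0⟩, fun _ _ i => i.elim0⟩
  | succ N ih =>
    obtain ⟨v, hv, hvA⟩ := ih fun k hk => hN k (by omega)
    let b := Module.finBasis ℝ G.edges
    -- The new vector must avoid all images of the old ones. Since the identity is an edge operator,
    -- this includes orthogonality to the old vectors themselves.
    let f : Fin N × Fin (Module.finrank ℝ G.edges) → V := fun ij => (b ij.2 : V →ₗ[ℂ] V) (v ij.1)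
    have hlt : Module.finrank ℂ (Submodule.span ℂ (Set.range f)) < Module.finrank ℂ V :=
      (finrank_range_le_card f).trans_lt (by simpa using hN N (by omega))
    have hne : (Submodule.span ℂ (Set.range f))ᗮ ≠ ⊥ := fun h => by
      rw [Submodule.orthogonal_eq_bot_iff] at h
      rw [h, finrank_top] at hlt
      exact lt_irrefl _ hlt
    obtain ⟨w₀, hw₀, hw₀0⟩ := Submodule.exists_mem_ne_zero_of_ne_bot hne
    obtain ⟨w, hw, hw1⟩ : ∃ w ∈ (Submodule.span ℂ (Set.range f))ᗮ, ‖w‖ = 1 :=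
      ⟨((‖w₀‖⁻¹ : ℝ) : ℂ) • w₀, Submodule.smul_mem _ _ hw₀, by
        rw [norm_smul]; simp [hw₀0]⟩
    have hAw (A : V →ₗ[ℂ] V) (hA : A ∈ G.edges) (i : Fin N) : ⟪w, A (v i)⟫_ℂ = 0 := by
      rw [show A = _ from b.coe_eq_sum_repr ⟨A, hA⟩]
      simp only [LinearMap.sum_apply, LinearMap.smul_apply, inner_sum]
      refine Finset.sum_eq_zero fun k _ => ?_
      have hf : f (i, k) ∈ Submodule.span ℂ (Set.range f) := Submodule.subset_span ⟨(i, k), rfl⟩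
      rw [RCLike.real_smul_eq_coe_smul (K := ℂ), inner_smul_right]
      exact mul_eq_zero_of_right _ (Submodule.inner_left_of_mem_orthogonal hf hw)
    have hwA (A : V →ₗ[ℂ] V) (hA : A ∈ G.edges) (i : Fin N) : ⟪v i, A w⟫_ℂ = 0 := by
      rw [← G.isSymmetric_of_mem A hA, inner_eq_zero_symm, hAw A hA i]
    have hoff : ∀ A ∈ G.edges, ∀ i j, i ≠ j →
        ⟪(Fin.snoc v w : Fin (N + 1) → V) i, A ((Fin.snoc v w : Fin (N + 1) → V) j)⟫_ℂ = 0 := by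
      intro A hA i j hij
      induction i using Fin.lastCases with
      | last =>
        induction j using Fin.lastCases with
        | last => exact absurd rfl hij
        | cast j => simpa using hAw A hA j
      | cast i =>
        induction j using Fin.lastCases with
        | last => simpa using hwA A hA i
        | cast j => simpa using hvA A hA i j (by simpa using hij)
    refine ⟨Fin.snoc v w, ⟨fun i => ?_, fun i j hij => hoff _ G.id_mem i j hij⟩, hoff⟩
    induction i using Fin.lastCases with
    | last => simpa using hw1
    | cast i => simpa using hv.1 i

/-- Nonzero vectors on which all edge operators have the same scalar compression span a code. -/
theorem isCode_span_range {κ : Type*} [DecidableEq κ] (G : QuantumGraph V)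
    {w : κ → V} {c : G.edges → ℝ} {c₀ : ℝ} (hc₀ : c₀ ≠ 0)
    (hw : ∀ a b, ⟪w a, w b⟫_ℂ = if a = b then (c₀ : ℂ) else 0)
    (h : ∀ A : G.edges, ∀ a b, ⟪w a, (A : V →ₗ[ℂ] V) (w b)⟫_ℂ = if a = b then (c A : ℂ) else 0) :
    G.IsCode (Submodule.span ℂ (Set.range w)) := by
  have hc : (c₀ : ℂ) ≠ 0 := by exact_mod_cast hc₀
  refine isCode_of_inner (fun A => c A / c₀) fun A x hx y hy => ?_
  induction hx using Submodule.span_induction with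
  | mem x hx =>
    obtain ⟨a, rfl⟩ := hx
    induction hy using Submodule.span_induction with
    | mem y hy =>
      obtain ⟨b, rfl⟩ := hy
      rw [h, hw]
      split_ifs
      · push_cast; field_simp
      · simp
    | zero => simp
    | add y z _ _ hy hz => rw [map_add, inner_add_right, inner_add_right, hy, hz, mul_add]
    | smul k y _ hy => rw [map_smul, inner_smul_right, inner_smul_right, hy]; ring
  | zero => simp
  | add y z _ _ hy hz => rw [inner_add_left, inner_add_left, hy, hz, mul_add]
  | smul k y _ hy => rw [inner_smul_left, inner_smul_left, hy]; ring

/-- Tverberg classes of expectation vectors give q + 1 orthogonal vectors of equal norm with the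
same expectation of every edge operator. -/
theorem lt_independenceNumber (G : QuantumGraph V) (q : ℕ)
    (hq : q * Module.finrank ℝ G.edges ^ 2 < Module.finrank ℂ V) : q < G.independenceNumber := by
  classical
  set D := Module.finrank ℝ G.edges
  obtain ⟨v, hv, hvA⟩ := G.exists_orthonormal_inner_eq_zero (q * D + 1) fun k hk =>
    lt_of_le_of_lt (by rw [pow_two, ← mul_assoc]; exact Nat.mul_le_mul_right _ (by omega)) hq
  let b := Module.finBasis ℝ G.edges
  obtain ⟨s, l, hl, y, hy⟩ := exists_equal_weighted_sums (ι := Fin (q * D + 1)) (δ := Fin D) q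
    (by simp) fun i k => (⟪v i, (b k : V →ₗ[ℂ] V) (v i)⟫_ℂ).re
  -- The common compression of an edge operator.
  let c : G.edges → ℝ := fun A => ∑ k, b.repr A k * y k
  have hc (A : G.edges) (a : Option (Fin q)) :
      ∑ i with s i = a, (l i : ℂ) * ⟪v i, (A : V →ₗ[ℂ] V) (v i)⟫_ℂ = c A := by
    have hre (B : G.edges) (i) : ⟪v i, (B : V →ₗ[ℂ] V) (v i)⟫_ℂ =
        ((⟪v i, (B : V →ₗ[ℂ] V) (v i)⟫_ℂ).re : ℂ) :=
      ((G.isSymmetric_of_mem B B.2).coe_re_inner_self_apply (v i)).symm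
    have hA (i) : ⟪v i, (A : V →ₗ[ℂ] V) (v i)⟫_ℂ =
        ∑ k, (b.repr A k : ℂ) * ((⟪v i, (b k : V →ₗ[ℂ] V) (v i)⟫_ℂ).re : ℂ) := by
      rw [b.coe_eq_sum_repr A]
      simp only [LinearMap.sum_apply, LinearMap.smul_apply, inner_sum]
      refine Finset.sum_congr rfl fun k _ => ?_
      rw [RCLike.real_smul_eq_coe_smul (K := ℂ), inner_smul_right, ← hre]
      rfl
    simp only [hA, Finset.mul_sum]
    rw [Finset.sum_comm]
    simp only [c, ← hy a, Finset.sum_apply, Pi.smul_apply, smul_eq_mul, Finset.mul_sum]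
    push_cast
    exact Finset.sum_congr rfl fun k _ => Finset.sum_congr rfl fun i _ => by ring
  -- Off-diagonal entries vanish, so the square roots turn expectations at `w a` into sums over the
  -- class weighted by `l`.
  let w : Option (Fin q) → V := fun a => ∑ i with s i = a, ((√(l i) : ℝ) : ℂ) • v i
  have hwA (A : G.edges) (a b) :
      ⟪w a, (A : V →ₗ[ℂ] V) (w b)⟫_ℂ = if a = b then (c A : ℂ) else 0 := by
    simp only [w, map_sum, map_smul, sum_inner, inner_sum, inner_smul_left, inner_smul_right]
    split_ifs with hab
    · subst hab
      rw [← hc A a]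
      refine Finset.sum_congr rfl fun i hi => ?_
      rw [Finset.sum_eq_single_of_mem i hi fun j _ hj => by
        rw [hvA A A.2 _ _ hj, mul_zero]]
      rw [← mul_assoc, Complex.conj_ofReal, ← Complex.ofReal_mul, Real.mul_self_sqrt (hl.1 i)]
    · refine Finset.sum_eq_zero fun i hi => mul_eq_zero_of_right _ <|
        Finset.sum_eq_zero fun j hj => mul_eq_zero_of_right _ <| hvA A A.2 j i ?_
      rintro rfl
      simp only [Finset.mem_filter, Finset.mem_univ, true_and] at hi hj
      exact hab (hj.symm.trans hi)
  -- `c I` is the total weight of each class; were it zero, the weights could not sum to 1.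
  let I : G.edges := ⟨LinearMap.id, G.id_mem⟩
  have hcI : c I ≠ 0 := by
    intro h0
    have hzero (a : Option (Fin q)) : ∑ i with s i = a, l i = 0 := by
      have := hc I a
      simp only [I, LinearMap.id_apply, inner_self_eq_norm_sq_to_K, hv.1] at this
      rw [h0] at this
      exact_mod_cast (by simpa using this : ∑ i with s i = a, (l i : ℂ) = 0)
    have := hl.2
    rw [← Finset.sum_fiberwise _ s] at this
    simp [hzero] at this
  have hw (a b) : ⟪w a, w b⟫_ℂ = if a = b then (c I : ℂ) else 0 := hwA I a b
  have hli : LinearIndependent ℂ w := linearIndependent_of_ne_zero_of_inner_eq_zero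
    (fun a h0 => hcI (by have := hw a a; simpa [h0] using this.symm))
    (fun a b hab => (hw a b).trans (if_neg hab))
  have := finrank_le_independenceNumber (G.isCode_span_range hcI hw hwA)
  rw [finrank_span_eq_card hli] at this
  simpa using this

end QuantumGraph

/-! ### Upper bound: a graph with only small codes -/

/-- A subspace of a finite-dimensional space can be enlarged within a given subspace to any
intermediate dimension. -/
theorem Submodule.exists_le_le_finrank_eq {K M : Type*} [DivisionRing K] [AddCommGroup M]
    [Module K M] [FiniteDimensional K M] {S T : Submodule K M} (hST : S ≤ T) {d : ℕ}
    (hS : Module.finrank K S ≤ d) (hT : d ≤ Module.finrank K T) :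
    ∃ E : Submodule K M, S ≤ E ∧ E ≤ T ∧ Module.finrank K E = d := by
  induction d, hS using Nat.le_induction with
  | base => exact ⟨S, le_rfl, hST, rfl⟩
  | succ d _ ih =>
    obtain ⟨E, hSE, hET, hE⟩ := ih (by omega)
    obtain ⟨x, hxT, hxE⟩ := SetLike.exists_of_lt
      (lt_of_le_of_ne hET fun h => by subst h; omega)
    refine ⟨E ⊔ Submodule.span K {x}, hSE.trans le_sup_left,
      sup_le hET (by simpa using hxT), ?_⟩
    apply le_antisymm
    · refine (Submodule.finrank_add_le_finrank_add_finrank _ _).trans ?_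
      have := finrank_span_le_card (R := K) ({x} : Set M)
      simp at this
      omega
    · rw [← hE]
      exact Submodule.finrank_lt_finrank_of_lt
        (lt_of_le_of_ne le_sup_left fun h => hxE (h ▸ Submodule.mem_sup_right
          (Submodule.mem_span_singleton_self x)))

/-- Real and imaginary parts make two copies of the self-adjoint operators surject onto all
operators, of real dimension 2n². -/
theorem sq_finrank_le_finrank_selfAdjoint (V : Type*) [NormedAddCommGroup V]
    [InnerProductSpace ℂ V] [FiniteDimensional ℂ V] :
    Module.finrank ℂ V ^ 2 ≤ Module.finrank ℝ (selfAdjoint.submodule ℝ (V →ₗ[ℂ] V)) := by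
  let S := selfAdjoint.submodule ℝ (V →ₗ[ℂ] V)
  let f : S × S →ₗ[ℝ] (V →ₗ[ℂ] V) := LinearMap.coprod S.subtype (Complex.I • S.subtype)
  have hf : Function.Surjective f := fun A =>
    ⟨(realPart A, imaginaryPart A), realPart_add_I_smul_imaginaryPart A⟩
  have h := LinearMap.finrank_le_finrank_of_surjective hf
  rw [finrank_real_of_complex, Module.finrank_linearMap, Module.finrank_prod, ← pow_two] at h
  change _ ≤ Module.finrank ℝ S
  omega

/-- Within a residue class the quotient by k determines the index, and it is less than n / k. -/
theorem card_filter_mod_eq_le (n k : ℕ) (hk : 0 < k) (j : ℕ) :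
    ((Finset.univ : Finset (Fin n)).filter fun i : Fin n => (i : ℕ) % k = j).card ≤
      ⌈(n : ℚ) / k⌉₊ := by
  have hinj : Set.InjOn (fun i : Fin n => (i : ℕ) / k)
      ((Finset.univ : Finset (Fin n)).filter fun i : Fin n => (i : ℕ) % k = j) := by
    intro a ha b hb hab
    simp only [Finset.coe_filter, Finset.mem_univ, true_and, Set.mem_ofPred_eq] at ha hb
    ext
    rw [← Nat.div_add_mod a k, ← Nat.div_add_mod b k, ha, hb]
    simp only at hab
    rw [hab]
  rw [← Finset.card_image_of_injOn hinj, ← Finset.card_range ⌈(n : ℚ) / k⌉₊]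
  refine Finset.card_le_card fun d hd => ?_
  obtain ⟨i, -, rfl⟩ := Finset.mem_image.1 hd
  rw [Finset.mem_range, Nat.lt_ceil]
  have hk' : (0 : ℚ) < k := by exact_mod_cast hk
  rw [lt_div_iff₀ hk']
  exact_mod_cast (Nat.div_mul_le_self (i : ℕ) k).trans_lt i.2

namespace QuantumGraph

variable {V : Type u} [NormedAddCommGroup V] [InnerProductSpace ℂ V] [FiniteDimensional ℂ V]

/-- If edge operators of rank at most `r` sum to the identity, then codes have dimension at
most `r`. -/
theorem IsCode.finrank_le_of_sum_eq_id {G : QuantumGraph V} {C : Submodule ℂ V} (hC : G.IsCode C)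
    {ι : Type*} [Fintype ι] {A : ι → V →ₗ[ℂ] V} (hA : ∀ i, A i ∈ G.edges)
    (hsum : ∑ i, A i = LinearMap.id) {r : ℕ} (hr : ∀ i, Module.finrank ℂ (A i).range ≤ r) :
    Module.finrank ℂ C ≤ r := by
  obtain ⟨ε, hε⟩ := hC
  by_cases h0 : ∀ i, ε ⟨A i, hA i⟩ = 0
  · suffices C = ⊥ from (Submodule.finrank_eq_zero.2 this).trans_le r.zero_le
    rw [Submodule.eq_bot_iff]
    intro x hx
    have hx' := Submodule.starProjection_eq_self_iff.2 hx
    have h1 (i) : C.starProjection (A i x) = 0 := by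
      have := LinearMap.congr_fun (hε ⟨A i, hA i⟩) x
      simpa [h0, hx'] using this
    calc x = C.starProjection ((∑ i, A i) x) := by rw [hsum]; simp [hx']
      _ = 0 := by simp [LinearMap.sum_apply, map_sum, h1]
  · push Not at h0
    obtain ⟨i, hi⟩ := h0
    refine le_trans ?_ (hr i)
    -- With nonzero slope, x = P A (ε⁻¹ x) for x in C, so C lies in the projected range.
    have hle : C ≤ (A i).range.map (C.starProjection : V →ₗ[ℂ] V) := by
      intro x hx
      have hx' := Submodule.starProjection_eq_self_iff.2 hx
      have := LinearMap.congr_fun (hε ⟨A i, hA i⟩) x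
      simp only [LinearMap.comp_apply, LinearMap.smul_apply, ContinuousLinearMap.coe_coe,
        hx'] at this
      refine ⟨A i ((ε ⟨A i, hA i⟩)⁻¹ • x), ⟨_, rfl⟩, ?_⟩
      rw [RCLike.real_smul_eq_coe_smul (K := ℂ), map_smul, map_smul, ContinuousLinearMap.coe_coe,
        this, ← RCLike.real_smul_eq_coe_smul (K := ℂ), smul_smul, inv_mul_cancel₀ hi, one_smul]
    exact (Submodule.finrank_mono hle).trans (Submodule.finrank_map_le _ _)

end QuantumGraph

theorem exists_quantumGraph_independenceNumber_le (n m : ℕ) (h : m + 1 ≤ n ^ 2) :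
    ∃ G : QuantumGraph (EuclideanSpace ℂ (ULift.{u} (Fin n))),
      G.order = n ∧ G.valence = m ∧ G.independenceNumber ≤ ⌈(n : ℚ) / ((m : ℚ) + 1)⌉₊ := by
  let V := EuclideanSpace ℂ (ULift.{u} (Fin n))
  have hV : Module.finrank ℂ V = n := by simp [V]
  let χ : Fin (m + 1) → ULift.{u} (Fin n) → ℂ := fun j i =>
    if (i.down : ℕ) % (m + 1) = j then 1 else 0
  let A : Fin (m + 1) → V →ₗ[ℂ] V := fun j => Matrix.toEuclideanLin (Matrix.diagonal (χ j))
  have hsa (j) : A j ∈ selfAdjoint.submodule ℝ (V →ₗ[ℂ] V) := by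
    refine (LinearMap.isSymmetric_iff_isSelfAdjoint _).1
      (Matrix.isSymmetric_toEuclideanLin_iff.2 ?_)
    refine Matrix.isHermitian_diagonal_of_self_adjoint _ ?_
    ext i
    simp [χ, apply_ite]
  have hdiag (d : ULift.{u} (Fin n) → ℂ) (x : EuclideanSpace ℂ (ULift.{u} (Fin n))) (i) :
      (Matrix.toEuclideanLin (Matrix.diagonal d) x).ofLp i = d i * x.ofLp i := by
    simp [Matrix.toLpLin_apply, Matrix.mulVec_diagonal]
  have hsum : ∑ j, A j = LinearMap.id := by
    ext x i
    have : ∑ j, χ j i = 1 := by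
      simp only [χ]
      rw [Finset.sum_eq_single ⟨(i.down : ℕ) % (m + 1), Nat.mod_lt _ (by omega)⟩]
      · simp
      · intro j _ hj
        exact if_neg fun h => hj (Fin.ext h.symm)
      · simp
    have hA (j) : (A j x).ofLp i = χ j i * x.ofLp i := hdiag _ _ _
    rw [LinearMap.sum_apply, WithLp.ofLp_sum, Finset.sum_apply,
      Finset.sum_congr rfl fun j _ => hA j, ← Finset.sum_mul, this, one_mul, LinearMap.id_apply]
  have hrank (j) : Module.finrank ℂ (A j).range ≤ ⌈(n : ℚ) / ((m : ℚ) + 1)⌉₊ := by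
    have hA : Module.finrank ℂ (A j).range = (Matrix.diagonal (χ j)).rank := by
      simp only [A, Matrix.toLpLin_eq_toLin]
      exact (Matrix.rank_eq_finrank_range_toLin _ _ _).symm
    rw [hA, Matrix.rank_diagonal]
    have hcard := card_filter_mod_eq_le n (m + 1) (by omega) j
    push_cast at hcard
    refine le_trans (le_of_eq ?_) hcard
    rw [← Fintype.card_subtype]
    refine Fintype.card_congr (Equiv.ulift.subtypeEquiv fun i => ?_)
    simp [χ]
  -- The projections may span fewer than m + 1 dimensions (some vanish when n < m + 1). Enlarging
  -- the edge space keeps them as edges, so the rank bound survives.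
  obtain ⟨E, hE, hEsa, hEd⟩ := Submodule.exists_le_le_finrank_eq
    (S := Submodule.span ℝ (Set.range A)) (T := selfAdjoint.submodule ℝ (V →ₗ[ℂ] V))
    (d := m + 1) (Submodule.span_le.2 (by rintro _ ⟨j, rfl⟩; exact hsa j))
    ((finrank_range_le_card A).trans (by simp))
    ((h.trans (by rw [hV])).trans (sq_finrank_le_finrank_selfAdjoint V))
  have hAE (j) : A j ∈ E := hE (Submodule.subset_span ⟨j, rfl⟩)
  refine ⟨⟨E, fun B hB => (LinearMap.isSymmetric_iff_isSelfAdjoint _).2 (hEsa hB),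
    hsum ▸ Submodule.sum_mem _ fun j _ => hAE j⟩, hV, ?_, ?_⟩
  · change (Module.finrank ℝ E : ℤ) - 1 = m
    rw [hEd]
    simp
  · exact QuantumGraph.independenceNumber_le fun C hC => hC.finrank_le_of_sum_eq_id hAE hsum hrank

theorem theorem1 (n m : ℕ) (h : m + 1 ≤ n ^ 2) :
    ⌈(n : ℚ) / ((m : ℚ) + 1)⌉₊ ≥ minIndependenceNumber.{u} n m ∧
      minIndependenceNumber.{u} n m ≥ ⌈(n : ℚ) / ((m : ℚ) + 1) ^ 2⌉₊ := by
  obtain ⟨G, hn, hm, hG⟩ := exists_quantumGraph_independenceNumber_le.{u} n m h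
  refine ⟨le_trans (Nat.sInf_le ⟨_, _, _, _, G, hn, hm, rfl⟩) hG,
    le_csInf ⟨_, _, _, _, _, G, hn, hm, rfl⟩ ?_⟩
  rintro _ ⟨V, _, _, _, G, hn, hm, rfl⟩
  have hD : Module.finrank ℝ G.edges = m + 1 := by
    unfold QuantumGraph.valence at hm
    omega
  -- Apply the strict bound with q = ⌈n / (m + 1)²⌉ - 1, the largest integer with q (m + 1)² < n.
  refine Nat.le_of_pred_lt (G.lt_independenceNumber _ ?_)
  have hn' : Module.finrank ℂ V = n := hn
  have hpos : 0 < n := Nat.pos_of_ne_zero (by rintro rfl; simp at h)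
  have hceil : 0 < ⌈(n : ℚ) / ((m : ℚ) + 1) ^ 2⌉₊ := Nat.ceil_pos.2 (by positivity)
  have hlt := Nat.lt_ceil.1 (Nat.sub_one_lt_of_lt hceil)
  rw [lt_div_iff₀ (by positivity)] at hlt
  rw [hD, hn']
  exact_mod_cast hlt
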